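/- Let $(S,\mathcal S,Q)$ be a probability space and $h:S\times\mathbb R\to\mathbb R$ such that $h(\cdot,t)$ is measurable for every $t\in\mathbb R$, $h(x,\cdot)$ is convex for every $x\in S$, and $\int_S|D^{+}h(x,t)|\,Q(dx)<\infty$ and $\int_S|D^{-}h(x,t)|\,Q(dx)<\infty$ for all $t\in\mathbb R$, where $D^{+}$ and $D^{-}$ denote right and left derivatives (of $h(x,\cdot)$ in the case of $h$). Fix $t_0\in\mathbb R$ and put $M(t)=\int_S \big(h(x,t)-h(x,t_0)\big)\,Q(dx)$. Let $X_1,X_2,\dots$ be i.i.d. $S$-valued random variables with distribution $Q$ on a probability space $(\Omega,\mathcal A,\mathbb P)$, let $M_n(t)=\frac1n\sum_{i=1}^n\big(h(X_i,t)-h(X_i,t_0)\big)$, assume that for every $n\ge1$ the function $M_n$ almost surely has a smallest minimizing point, and let $\hat m_n$ denote that point. Let $m$ be the unique minimizing point of $M$. For $s\ge 2$ suppose that for some $x_0>0$ $$R_s(x):=\mathbb E\big[|D^{+}h(X_1,m+x)|^s\big]<\infty\quad\text{for all }x\in[-x_0,x_0].$$ Put $d(x)=\min\{D^{+}M(m+x),-D^{+}M(m-x)\}$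 and $\mu_s(x)=\max\{R_s(x),R_s(-x)\}$. Then there is a positive real constant $B_s$, depending only on $s$, such that for all $x\in(0,x_0]$ and all integers $n\ge1$: $d(x)>0$, $\mu_s(x)<\infty$, and $$\mathbb P\Big(\sup_{k\ge n}(\hat m_k-m)>x\Big)\le 2^sB_sR_s(x)\big(D^{+}M(m+x)\big)^{-s}n^{-s/2},$$ $$\mathbb P\Big(\inf_{k\ge n}(\hat m_k-m)<-x\Big)\le 2^sB_sR_s(-x)\big(-D^{+}M(m-x)\big)^{-s}n^{-s/2},$$ $$\mathbb P\Big(\sup_{k\ge n}|\hat m_k-m|>x\Big)\le 2^{s+1}B_s\,\mu_s(x)\,d(x)^{-s}n^{-s/2}.$$ -/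

import Mathlib

open MeasureTheory ProbabilityTheory
open scoped ENNReal

namespace ConvexMEst

noncomputable section

/-- The right derivative `D⁺f(t)`. -/
def rightD (f : ℝ → ℝ) (t : ℝ) : ℝ := derivWithin f (Set.Ioi t) t

/-- The left derivative `D⁻f(t)`. -/
def leftD (f : ℝ → ℝ) (t : ℝ) : ℝ := derivWithin f (Set.Iio t) t

/-- The set of all minimizing points of `f`. -/
def argminSet (f : ℝ → ℝ) : Set ℝ := {t | ∀ u, f t ≤ f u}

/-- The criterion function `M(t) = ∫ h(x,t) - h(x,t₀) Q(dx)`. -/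
def criterion {S : Type*} [MeasurableSpace S] (Q : Measure S) (h : S → ℝ → ℝ) (t₀ t : ℝ) : ℝ :=
  ∫ x, (h x t - h x t₀) ∂Q

/-- The empirical criterion function `Mₙ(t) = (1/n) ∑_{i ≤ n} (h(Xᵢ,t) - h(Xᵢ,t₀))` at the
sample point `ω`; the variables `X₁, X₂, …` are indexed as `X 0, X 1, …`. -/
def empCriterion {S Ω : Type*} (h : S → ℝ → ℝ) (t₀ : ℝ) (X : ℕ → Ω → S) (n : ℕ) (ω : Ω)
    (t : ℝ) : ℝ :=
  (1 / (n : ℝ)) * ∑ i ∈ Finset.range n, (h (X i ω) t - h (X i ω) t₀)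

/-- The convex M-estimator `m̂ₙ`: the smallest minimizing point of `Mₙ`. The infimum is that
point whenever a smallest minimizing point exists, see `mHat_isLeast`. -/
def mHat {S Ω : Type*} (h : S → ℝ → ℝ) (t₀ : ℝ) (X : ℕ → Ω → S) (n : ℕ) (ω : Ω) : ℝ :=
  sInf (argminSet (empCriterion h t₀ X n ω))

theorem mHat_isLeast {S Ω : Type*} {h : S → ℝ → ℝ} {t₀ : ℝ} {X : ℕ → Ω → S} {n : ℕ} {ω : Ω}
    (hex : ∃ t, IsLeast (argminSet (empCriterion h t₀ X n ω)) t) :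
    IsLeast (argminSet (empCriterion h t₀ X n ω)) (mHat h t₀ X n ω) := by
  obtain ⟨t, ht⟩ := hex
  have e : mHat h t₀ X n ω = t := ht.csInf_eq
  rw [e]
  exact ht

/-- `R_s(x) = E[|D⁺h(Y, m + x)|^s]`, as an extended nonnegative number. -/
def absMoment {S Ω : Type*} [MeasurableSpace Ω] (P : Measure Ω) (h : S → ℝ → ℝ) (Y : Ω → S)
    (m s x : ℝ) : ℝ≥0∞ :=
  ∫⁻ ω, ENNReal.ofReal (|rightD (h (Y ω)) (m + x)| ^ s) ∂P

/-- `μ_s(x) = max {R_s(x), R_s(-x)}`. -/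
def maxMoment {S Ω : Type*} [MeasurableSpace Ω] (P : Measure Ω) (h : S → ℝ → ℝ) (Y : Ω → S)
    (m s x : ℝ) : ℝ≥0∞ :=
  max (absMoment P h Y m s x) (absMoment P h Y m s (-x))

/-- `d(x) = min {D⁺M(m + x), -D⁺M(m - x)}`. -/
def slopeGap (M : ℝ → ℝ) (m x : ℝ) : ℝ := min (rightD M (m + x)) (-rightD M (m - x))

end

end ConvexMEst

/-! Convexity turns the position of a minimizer into the sign of a sum. If the smallest minimizer of
`M_k` exceeds `m + x`, then `∑ D⁺h(X_i, m + x)` over the first `k` indices is negative, while its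
mean is `k * D⁺M(m + x)`, which is positive because `m` is the only minimizer of `M`. So the centred
sum has modulus at least `ε k` with `ε = D⁺M(m + x)`; below `m - x` the signs are reversed.

It remains to bound the probability that `|S_k| ≥ ε k` for some `k ≥ n`, where `S_k` sums
independent centred variables (`exists_measure_tail_average_le`). A one-step expansion of `|a +
b|^s` gives `E|S_n|^s ≤ K n^(s/2) L` by induction, with `K` depending on `s` only. Doob's inequality
for the submartingale `|S_k|^s` controls each dyadic block of `k`, and the block bounds sum
geometrically. Centring costs the factor `2^s`, and the two-sided bound one more factor 2. -/

namespace ConvexMEst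

/-! ### Inequalities for real powers -/

theorem rpow_tangent_le {p a u : ℝ} (hp : 1 ≤ p) (ha : 0 ≤ a) (hu : 0 ≤ u) :
    a ^ p + p * a ^ (p - 1) * (u - a) ≤ u ^ p := by
  rcases ha.eq_or_lt with rfl | ha
  · rcases hp.eq_or_lt with rfl | hp
    · simp
    · rw [Real.zero_rpow (by linarith), Real.zero_rpow (by linarith)]
      simpa using Real.rpow_nonneg hu p
  · have h1 : -1 ≤ u / a - 1 := by
      have := div_nonneg hu ha.le
      linarith
    -- Bernoulli's inequality for the ratio `u / a`; multiplying by `a ^ p` gives the tangent line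
    -- at `a`.
    have h2 := one_add_mul_self_le_rpow_one_add h1 hp
    have h3 : (1 + (u / a - 1)) ^ p = u ^ p / a ^ p := by
      rw [add_sub_cancel, Real.div_rpow hu ha.le]
    have hap := Real.rpow_pos_of_pos ha p
    rw [h3, le_div_iff₀ hap] at h2
    have h4 : a ^ p = a ^ (p - 1) * a := by
      rw [Real.rpow_sub_one ha.ne']
      field_simp
    calc a ^ p + p * a ^ (p - 1) * (u - a) = (1 + p * (u / a - 1)) * a ^ p := by
          rw [h4]; field_simp
      _ ≤ u ^ p := h2

theorem rpow_sub_two_mul_self {s a : ℝ} (hs : 2 ≤ s) (ha : 0 ≤ a) :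
    a ^ (s - 2) * a = a ^ (s - 1) := by
  have := Real.rpow_add_of_nonneg ha (by linarith : 0 ≤ s - 2) zero_le_one
  rw [Real.rpow_one] at this
  rw [← this]
  congr 1
  ring

theorem rpow_sub_two_mul_sq {s a : ℝ} (hs : 2 ≤ s) (ha : 0 ≤ a) :
    a ^ (s - 2) * a ^ 2 = a ^ s := by
  have := Real.rpow_add_of_nonneg ha (by linarith : 0 ≤ s - 2) zero_le_two
  rw [Real.rpow_two] at this
  rw [← this]
  congr 1
  ring

theorem abs_rpow_tangent_le {s : ℝ} (hs : 2 ≤ s) (a b : ℝ) :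
    |a| ^ s + s * (|a| ^ (s - 2) * a) * b ≤ |a + b| ^ s := by
  have h := rpow_tangent_le (by linarith : 1 ≤ s) (abs_nonneg a) (abs_nonneg (a + b))
  refine le_trans ?_ h
  rw [← rpow_sub_two_mul_self hs (abs_nonneg a)]
  have h1 : a * (a + b) ≤ |a| * |a + b| := by
    rw [← abs_mul]; exact le_abs_self _
  have h2 : a * b ≤ |a| * (|a + b| - |a|) := by
    have := abs_mul_abs_self a
    nlinarith
  have h3 : 0 ≤ s * |a| ^ (s - 2) := by positivity
  have := mul_le_mul_of_nonneg_left h2 h3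
  linarith

/-- A Lipschitz bound for `u ↦ |u|^(s-2) u` without differentiation. The term `|u|^(s-2) (u - v)`
contributes 1 to the constant; the tangent inequality with exponent `s - 1` bounds the remainder and
contributes `s - 2`. -/
theorem abs_rpow_mul_sub_le_of_abs_le {s u v : ℝ} (hs : 2 ≤ s) (h : |v| ≤ |u|) :
    |(|u| ^ (s - 2) * u - |v| ^ (s - 2) * v)| ≤ (s - 1) * |u| ^ (s - 2) * |u - v| := by
  have hpow : |v| ^ (s - 2) ≤ |u| ^ (s - 2) :=
    Real.rpow_le_rpow (abs_nonneg v) h (by linarith)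
  have hT := rpow_tangent_le (by linarith : 1 ≤ s - 1) (abs_nonneg u) (abs_nonneg v)
  rw [show s - 1 - 1 = s - 2 by ring, ← rpow_sub_two_mul_self hs (abs_nonneg u),
    ← rpow_sub_two_mul_self hs (abs_nonneg v)] at hT
  have hu0 : 0 ≤ |u| ^ (s - 2) := by positivity
  have e : |u| ^ (s - 2) * u - |v| ^ (s - 2) * v
      = |u| ^ (s - 2) * (u - v) + (|u| ^ (s - 2) - |v| ^ (s - 2)) * v := by ring
  rw [e]
  refine (abs_add_le _ _).trans ?_
  rw [abs_mul, abs_mul, abs_of_nonneg hu0, abs_of_nonneg (sub_nonneg.2 hpow)]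
  have h5 : |u| - |v| ≤ |u - v| := abs_sub_abs_le_abs_sub u v
  have h6 : 0 ≤ (s - 2) * |u| ^ (s - 2) := mul_nonneg (by linarith) hu0
  have := mul_le_mul_of_nonneg_left h5 h6
  nlinarith

theorem abs_rpow_mul_sub_le {s : ℝ} (hs : 2 ≤ s) (u v : ℝ) :
    |(|u| ^ (s - 2) * u - |v| ^ (s - 2) * v)| ≤ (s - 1) * max |u| |v| ^ (s - 2) * |u - v| := by
  rcases le_total |v| |u| with h | h
  · rw [max_eq_left h]
    exact abs_rpow_mul_sub_le_of_abs_le hs h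
  · rw [max_eq_right h, abs_sub_comm, abs_sub_comm u v]
    exact abs_rpow_mul_sub_le_of_abs_le hs h

/-- The tangent at `a + b`, evaluated at `a`, bounds `|a + b|^s` above with slope taken at `a + b`.
The Lipschitz bound moves the slope back to `a`, at the cost of the last term. -/
theorem abs_add_rpow_le {s : ℝ} (hs : 2 ≤ s) (a b : ℝ) :
    |a + b| ^ s ≤ |a| ^ s + s * (|a| ^ (s - 2) * a) * b
      + s * (s - 1) * 2 ^ (s - 2) * (|a| ^ (s - 2) * b ^ 2 + |b| ^ s) := by
  have h1 := abs_rpow_tangent_le hs (a + b) (-b)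
  rw [add_neg_cancel_right] at h1
  have h2 : (|a + b| ^ (s - 2) * (a + b) - |a| ^ (s - 2) * a) * b
      ≤ (s - 1) * max |a + b| |a| ^ (s - 2) * |b| * |b| := by
    refine (le_abs_self _).trans ?_
    rw [abs_mul]
    have := abs_rpow_mul_sub_le hs (a + b) a
    rw [add_sub_cancel_left] at this
    exact mul_le_mul_of_nonneg_right this (abs_nonneg b)
  have h3 : max |a + b| |a| ≤ 2 * max |a| |b| := by
    have := abs_add_le a b
    have := le_max_left |a| |b|
    have := le_max_right |a| |b|
    have := abs_nonneg a
    exact max_le (by linarith) (by linarith)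
  have h4 : max |a + b| |a| ^ (s - 2) ≤ 2 ^ (s - 2) * (|a| ^ (s - 2) + |b| ^ (s - 2)) := by
    refine (Real.rpow_le_rpow (by positivity) h3 (by linarith)).trans ?_
    rw [Real.mul_rpow (by norm_num) (by positivity)]
    refine mul_le_mul_of_nonneg_left ?_ (by positivity)
    have ha : 0 ≤ |a| ^ (s - 2) := by positivity
    have hb : 0 ≤ |b| ^ (s - 2) := by positivity
    rcases max_choice |a| |b| with h | h <;> rw [h] <;> linarith
  have h5 := rpow_sub_two_mul_sq hs (abs_nonneg b)
  rw [sq_abs] at h5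
  have h6 : |b| * |b| = b ^ 2 := by rw [abs_mul_abs_self]; ring
  rw [mul_assoc _ |b|, h6] at h2
  have h7 : (s - 1) * max |a + b| |a| ^ (s - 2) * b ^ 2
      ≤ (s - 1) * (2 ^ (s - 2) * (|a| ^ (s - 2) + |b| ^ (s - 2))) * b ^ 2 := by
    gcongr
    linarith
  have h8 := mul_le_mul_of_nonneg_left (h2.trans h7) (by linarith : 0 ≤ s)
  rw [← h5]
  linarith

/-- A one-step moment inequality whose second-order term is split between the accumulated sum
and the new increment at a scale `k`. -/
theorem exists_abs_add_rpow_le {s : ℝ} (hs : 2 ≤ s) :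
    ∃ C : ℝ, 0 ≤ C ∧ ∀ k : ℝ, 1 ≤ k → ∀ a b : ℝ,
      |a + b| ^ s ≤ (1 + 1 / (2 * k)) * |a| ^ s + s * (|a| ^ (s - 2) * a) * b
        + C * k ^ (s / 2 - 1) * |b| ^ s := by
  set c : ℝ := s * (s - 1) * 2 ^ (s - 2) with hc
  have hc0 : 0 < c := by
    have : 0 < s - 1 := by linarith
    positivity
  refine ⟨c * (2 * c) ^ (s / 2 - 1) + c, by positivity, fun k hk a b => ?_⟩
  have hk0 : 0 < k := by linarith
  have h1 := abs_add_rpow_le hs a b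
  rw [← hc] at h1
  have hkp : 1 ≤ k ^ (s / 2 - 1) := Real.one_le_rpow hk (by linarith)
  have hbs : 0 ≤ |b| ^ s := by positivity
  have h2 : c * |b| ^ s ≤ c * k ^ (s / 2 - 1) * |b| ^ s := by
    have := mul_le_mul_of_nonneg_left hkp hc0.le
    rw [mul_one] at this
    exact mul_le_mul_of_nonneg_right this hbs
  have h3 : c * (|a| ^ (s - 2) * b ^ 2) ≤ 1 / (2 * k) * |a| ^ s
      + c * (2 * c) ^ (s / 2 - 1) * k ^ (s / 2 - 1) * |b| ^ s := by
    have ha0 : 0 ≤ |a| ^ (s - 2) := by positivity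
    -- Either `a ^ 2` dominates and the mixed term is absorbed in `|a|^s / (2k)`, or `|a|` is at
    -- most a multiple of `√k |b|`, which produces `k^(s/2-1) |b|^s`.
    rcases le_total (2 * k * c * b ^ 2) (a ^ 2) with h | h
    · have e1 : c * (|a| ^ (s - 2) * b ^ 2) ≤ 1 / (2 * k) * |a| ^ s := by
        rw [← rpow_sub_two_mul_sq hs (abs_nonneg a), sq_abs, one_div, ← div_eq_inv_mul,
          le_div_iff₀ (by positivity)]
        have := mul_le_mul_of_nonneg_left h ha0
        linarith
      have e2 : 0 ≤ c * (2 * c) ^ (s / 2 - 1) * k ^ (s / 2 - 1) * |b| ^ s := by positivity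
      linarith
    · have e0 : |a| ^ (s - 2) = (a ^ 2) ^ (s / 2 - 1) := by
        rw [← sq_abs, ← Real.rpow_two, ← Real.rpow_mul (abs_nonneg a)]
        congr 1
        ring
      have e0' : |b| ^ (s - 2) = (b ^ 2) ^ (s / 2 - 1) := by
        rw [← sq_abs, ← Real.rpow_two, ← Real.rpow_mul (abs_nonneg b)]
        congr 1
        ring
      have e1 : |a| ^ (s - 2) ≤ (2 * c) ^ (s / 2 - 1) * k ^ (s / 2 - 1) * |b| ^ (s - 2) := by
        rw [e0, e0', ← Real.mul_rpow (by positivity) (by positivity),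
          ← Real.mul_rpow (by positivity) (by positivity)]
        refine Real.rpow_le_rpow (by positivity) ?_ (by linarith)
        linarith
      have e2 : 0 ≤ 1 / (2 * k) * |a| ^ s := by positivity
      have e3 := mul_le_mul_of_nonneg_left
        (mul_le_mul_of_nonneg_right e1 (sq_nonneg b)) hc0.le
      rw [← rpow_sub_two_mul_sq hs (abs_nonneg b), sq_abs]
      linarith
  linarith

/-! ### The right derivative as a subgradient -/

theorem ConvexOn.subgradient_le {f : ℝ → ℝ} (hf : ConvexOn ℝ Set.univ f) (y u : ℝ) :
    f y + rightD f y * (u - y) ≤ f u := by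
  have hy : y ∈ interior (Set.univ : Set ℝ) := by simp
  rcases lt_trichotomy y u with h | rfl | h
  · have := hf.rightDeriv_le_slope_of_mem_interior hy (Set.mem_univ u) h
    rw [slope_def_field, le_div_iff₀ (by linarith)] at this
    unfold rightD
    linarith
  · simp
  · have h1 := hf.slope_le_leftDeriv_of_mem_interior (Set.mem_univ u) hy h
    have h2 := h1.trans (hf.leftDeriv_le_rightDeriv_of_mem_interior hy)
    rw [slope_def_field, div_le_iff₀ (by linarith)] at h2
    unfold rightD
    linarith

/-! ### Moments and tails of sums of independent centred variables -/

section PartialSums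

variable {Ω : Type*} [mΩ : MeasurableSpace Ω] {P : Measure Ω} {η : ℕ → Ω → ℝ} {s : ℝ}

theorem integral_mul_eq_zero_of_indep {m : MeasurableSpace Ω} {G Y : Ω → ℝ} (hm : m ≤ mΩ)
    (hG : Measurable[m] G) (hY : Measurable[mΩ] Y)
    (hind : Indep (MeasurableSpace.comap Y inferInstance) m P) (h0 : ∫ ω, Y ω ∂P = 0) :
    ∫ ω, G ω * Y ω ∂P = 0 := by
  have hi : IndepFun G Y P := by
    rw [IndepFun_iff_Indep]
    exact (indep_of_indep_of_le_right hind hG.comap_le).symm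
  rw [hi.integral_fun_mul_eq_mul_integral (hG.mono hm le_rfl).aestronglyMeasurable
    hY.aestronglyMeasurable, h0, mul_zero]

/-- Integrability of `|f|^s` and `L^s`-membership agree. -/
theorem memLp_of_integrable_abs_rpow {f : Ω → ℝ} (hs : 2 ≤ s) (hf : Measurable f)
    (hi : Integrable (fun ω => |f ω| ^ s) P) : MemLp f (ENNReal.ofReal s) P := by
  have h0 : ENNReal.ofReal s ≠ 0 := by
    simp only [ne_eq, ENNReal.ofReal_eq_zero, not_le]; linarith
  rw [← integrable_norm_rpow_iff hf.aestronglyMeasurable h0 ENNReal.ofReal_ne_top,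
    ENNReal.toReal_ofReal (by linarith)]
  exact hi

theorem integrable_abs_rpow_of_memLp {f : Ω → ℝ} (hs : 2 ≤ s)
    (hf : MemLp f (ENNReal.ofReal s) P) : Integrable (fun ω => |f ω| ^ s) P := by
  have h0 : ENNReal.ofReal s ≠ 0 := by
    simp only [ne_eq, ENNReal.ofReal_eq_zero, not_le]; linarith
  have := hf.integrable_norm_rpow h0 ENNReal.ofReal_ne_top
  rw [ENNReal.toReal_ofReal (by linarith)] at this
  exact this

theorem integrable_abs_sum_rpow (hs : 2 ≤ s) (hη : ∀ i, Measurable (η i))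
    (hi : ∀ i, Integrable (fun ω => |η i ω| ^ s) P) (n : ℕ) :
    Integrable (fun ω => |∑ i ∈ Finset.range n, η i ω| ^ s) P :=
  integrable_abs_rpow_of_memLp hs
    (memLp_finsetSum _ fun i _ => memLp_of_integrable_abs_rpow hs (hη i) (hi i))

theorem measurable_abs_rpow_mul (s : ℝ) : Measurable fun a : ℝ => |a| ^ (s - 2) * a := by
  fun_prop

theorem abs_rpow_mul_mul_le (hs : 2 ≤ s) (a b : ℝ) :
    |(|a| ^ (s - 2) * a * b)| ≤ |a| ^ s + |b| ^ s := by
  rw [abs_mul, abs_mul, abs_of_nonneg (by positivity : 0 ≤ |a| ^ (s - 2))]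
  have ha : 0 ≤ |a| ^ s := by positivity
  have hb : 0 ≤ |b| ^ s := by positivity
  rcases le_total |b| |a| with h | h
  · calc |a| ^ (s - 2) * |a| * |b| ≤ |a| ^ (s - 2) * |a| * |a| := by gcongr
      _ = |a| ^ s := by rw [← rpow_sub_two_mul_sq hs (abs_nonneg a)]; ring
      _ ≤ _ := by linarith
  · calc |a| ^ (s - 2) * |a| * |b| ≤ |b| ^ (s - 2) * |b| * |b| := by
          gcongr
      _ = |b| ^ s := by rw [← rpow_sub_two_mul_sq hs (abs_nonneg b)]; ring
      _ ≤ _ := by linarith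

theorem integrable_abs_rpow_mul_mul {f g : Ω → ℝ} (hs : 2 ≤ s) (hf : Measurable f)
    (hg : Measurable g) (hfi : Integrable (fun ω => |f ω| ^ s) P)
    (hgi : Integrable (fun ω => |g ω| ^ s) P) :
    Integrable (fun ω => |f ω| ^ (s - 2) * f ω * g ω) P := by
  refine (hfi.add hgi).mono' ?_ (Filter.Eventually.of_forall fun ω => ?_)
  · exact (((measurable_abs_rpow_mul s).comp hf).mul hg).aestronglyMeasurable
  · exact abs_rpow_mul_mul_le hs _ _

/-- The natural filtration at time `n` includes `η n`, hence the `n + 1` summands; the same shift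
recurs below. -/
theorem measurable_natural_sum (hη : ∀ i, Measurable (η i)) (n : ℕ) :
    Measurable[Filtration.natural η (fun i => (hη i).stronglyMeasurable) n]
      (fun ω => ∑ i ∈ Finset.range (n + 1), η i ω) := by
  refine Finset.measurable_fun_sum _ fun i hi => ?_
  have hle : i ≤ n := Nat.lt_succ_iff.1 (Finset.mem_range.1 hi)
  exact ((Filtration.stronglyAdapted_natural (fun i => (hη i).stronglyMeasurable) i).measurable).mono
    ((Filtration.natural η fun i => (hη i).stronglyMeasurable).mono hle) le_rfl

/-- The first-order term of the increment of `|∑ η i|^s` has integral zero over past events. -/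
theorem setIntegral_cross_eq_zero (hη : ∀ i, Measurable (η i)) (hind : iIndepFun η P)
    (h0 : ∀ i, ∫ ω, η i ω ∂P = 0) (n : ℕ) (A : Set Ω)
    (hA : MeasurableSet[Filtration.natural η (fun i => (hη i).stronglyMeasurable) n] A) :
    ∫ ω in A, |∑ i ∈ Finset.range (n + 1), η i ω| ^ (s - 2)
      * (∑ i ∈ Finset.range (n + 1), η i ω) * η (n + 1) ω ∂P = 0 := by
  set F := Filtration.natural η (fun i => (hη i).stronglyMeasurable) with hF
  rw [← integral_indicator (F.le n _ hA)]
  have hG : Measurable[F n] (A.indicator fun ω => |∑ i ∈ Finset.range (n + 1), η i ω| ^ (s - 2)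
      * (∑ i ∈ Finset.range (n + 1), η i ω)) :=
    Measurable.indicator ((measurable_abs_rpow_mul s).comp (measurable_natural_sum hη n)) hA
  rw [← integral_mul_eq_zero_of_indep (P := P) (F.le n) hG (hη (n + 1))
    (hind.indep_comap_natural_of_lt (fun i => (hη i).stronglyMeasurable) (Nat.lt_succ_self n))
    (h0 (n + 1))]
  congr 1
  ext ω
  by_cases h : ω ∈ A <;> simp [h]

/-- Independence removes the linear term. Choosing the scale `k = n + 1` keeps the growth factor `1
+ 1/(2k)` small enough for the order `n^(s/2)`. -/
theorem integral_abs_sum_rpow_succ_le (hs : 2 ≤ s) {C : ℝ}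
    (hC : ∀ k : ℝ, 1 ≤ k → ∀ a b : ℝ,
      |a + b| ^ s ≤ (1 + 1 / (2 * k)) * |a| ^ s + s * (|a| ^ (s - 2) * a) * b
        + C * k ^ (s / 2 - 1) * |b| ^ s)
    (hη : ∀ i, Measurable (η i)) (hind : iIndepFun η P)
    (h0 : ∀ i, ∫ ω, η i ω ∂P = 0) (hi : ∀ i, Integrable (fun ω => |η i ω| ^ s) P)
    (n : ℕ) :
    ∫ ω, |∑ i ∈ Finset.range (n + 2), η i ω| ^ s ∂P ≤
      (1 + 1 / (2 * (n + 1 : ℝ))) * ∫ ω, |∑ i ∈ Finset.range (n + 1), η i ω| ^ s ∂P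
        + C * (n + 1 : ℝ) ^ (s / 2 - 1) * ∫ ω, |η (n + 1) ω| ^ s ∂P := by
  have hS : Measurable fun ω => ∑ i ∈ Finset.range (n + 1), η i ω :=
    Finset.measurable_fun_sum _ fun i _ => hη i
  have hSi := integrable_abs_sum_rpow hs hη hi (n + 1)
  have hcr := integrable_abs_rpow_mul_mul hs hS (hη (n + 1)) hSi (hi (n + 1))
  have hz := setIntegral_cross_eq_zero (s := s) hη hind h0 n Set.univ MeasurableSet.univ
  rw [setIntegral_univ] at hz
  have hpt : ∀ ω, |∑ i ∈ Finset.range (n + 2), η i ω| ^ s ≤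
      ((1 + 1 / (2 * (n + 1 : ℝ))) * |∑ i ∈ Finset.range (n + 1), η i ω| ^ s
        + s * (|∑ i ∈ Finset.range (n + 1), η i ω| ^ (s - 2)
          * (∑ i ∈ Finset.range (n + 1), η i ω) * η (n + 1) ω))
        + C * (n + 1 : ℝ) ^ (s / 2 - 1) * |η (n + 1) ω| ^ s := by
    intro ω
    rw [Finset.sum_range_succ _ (n + 1)]
    have := hC (n + 1 : ℝ) (by linarith [n.cast_nonneg (α := ℝ)])
      (∑ i ∈ Finset.range (n + 1), η i ω) (η (n + 1) ω)
    linarith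
  have hI := integral_mono (integrable_abs_sum_rpow hs hη hi (n + 2))
    (((hSi.const_mul _).add (hcr.const_mul s)).add ((hi (n + 1)).const_mul _)) hpt
  refine hI.trans_eq ?_
  simp only [Pi.add_apply]
  rw [integral_add, integral_add, integral_const_mul, integral_const_mul, integral_const_mul, hz]
  · ring
  · exact hSi.const_mul _
  · exact hcr.const_mul s
  · exact (hSi.const_mul _).add (hcr.const_mul s)
  · exact (hi (n + 1)).const_mul _

/-- Moment bound of Marcinkiewicz–Zygmund type for sums of independent centred variables. -/
theorem exists_integral_abs_sum_rpow_le {s : ℝ} (hs : 2 ≤ s) :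
    ∃ K : ℝ, 0 < K ∧ ∀ {Ω : Type*} [MeasurableSpace Ω] {P : Measure Ω} {η : ℕ → Ω → ℝ} {L : ℝ},
      (∀ i, Measurable (η i)) → iIndepFun η P → (∀ i, ∫ ω, η i ω ∂P = 0) →
      (∀ i, Integrable (fun ω => |η i ω| ^ s) P) → (∀ i, ∫ ω, |η i ω| ^ s ∂P ≤ L) →
      ∀ n : ℕ, ∫ ω, |∑ i ∈ Finset.range n, η i ω| ^ s ∂P ≤ K * (n : ℝ) ^ (s / 2) * L := by
  obtain ⟨C, hC0, hC⟩ := exists_abs_add_rpow_le hs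
  -- Since `(1 + 1/(2k)) k = k + 1/2`, each induction step leaves room for half the constant, and
  -- `(2C + 1)/2 ≥ C` pays for the new increment.
  refine ⟨2 * C + 1, by positivity, ?_⟩
  intro Ω _ P η L hη hind h0 hi hL n
  have hL0 : 0 ≤ L := (integral_nonneg fun ω => by positivity).trans (hL 0)
  rcases n with _ | n
  · have h1 : (0 : ℝ) ^ s = 0 := Real.zero_rpow (by linarith)
    have h2 : (0 : ℝ) ^ (s / 2) = 0 := Real.zero_rpow (by linarith)
    simp [h1, h2]
  induction n with
  | zero =>
    simp only [zero_add, Finset.range_one, Finset.sum_singleton, Nat.cast_one, Real.one_rpow,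
      mul_one]
    refine (hL 0).trans ?_
    nlinarith [mul_nonneg hC0 hL0]
  | succ n ih =>
    refine (integral_abs_sum_rpow_succ_le hs hC hη hind h0 hi n).trans ?_
    push_cast at ih ⊢
    set k : ℝ := (n : ℝ) + 1 with hk
    have hk1 : 1 ≤ k := by linarith [n.cast_nonneg (α := ℝ)]
    have hk0 : 0 < k := by linarith
    set q := k ^ (s / 2 - 1) with hq
    have hq0 : 0 < q := Real.rpow_pos_of_pos hk0 _
    have e1 : k ^ (s / 2) = q * k := by
      rw [hq, Real.rpow_sub_one hk0.ne']; field_simp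
    have e2 : q * (k + 1) ≤ (k + 1) ^ (s / 2) := by
      have : (k + 1) ^ (s / 2) = (k + 1) ^ (s / 2 - 1) * (k + 1) := by
        rw [Real.rpow_sub_one (by positivity)]; field_simp
      rw [this]
      refine mul_le_mul_of_nonneg_right ?_ (by positivity)
      exact Real.rpow_le_rpow hk0.le (by linarith) (by linarith)
    rw [e1] at ih
    calc _ ≤ (1 + 1 / (2 * k)) * ((2 * C + 1) * (q * k) * L) + C * q * L := by
          gcongr
          exact hL _
      _ = q * L * ((2 * C + 1) * (k + 1 / 2) + C) := by field_simp
      _ ≤ q * L * ((2 * C + 1) * (k + 1)) := by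
          gcongr
          linarith
      _ = (2 * C + 1) * (q * (k + 1)) * L := by ring
      _ ≤ (2 * C + 1) * (k + 1) ^ (s / 2) * L := by gcongr

/-- By the tangent inequality the increment of `|S|^s` is at least its linear term, whose integral
over every past event vanishes. -/
theorem submartingale_abs_sum_rpow [IsFiniteMeasure P] (hs : 2 ≤ s) (hη : ∀ i, Measurable (η i))
    (hind : iIndepFun η P)
    (h0 : ∀ i, ∫ ω, η i ω ∂P = 0) (hi : ∀ i, Integrable (fun ω => |η i ω| ^ s) P) :
    Submartingale (fun n ω => |∑ i ∈ Finset.range (n + 1), η i ω| ^ s)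
      (Filtration.natural η fun i => (hη i).stronglyMeasurable) P := by
  refine submartingale_of_setIntegral_le_succ (fun n => ?_)
    (fun n => integrable_abs_sum_rpow hs hη hi (n + 1)) fun n A hA => ?_
  · have hm : Measurable fun a : ℝ => |a| ^ s := by fun_prop
    exact (hm.comp (measurable_natural_sum hη n)).stronglyMeasurable
  · have hS : Measurable fun ω => ∑ i ∈ Finset.range (n + 1), η i ω :=
      Finset.measurable_fun_sum _ fun i _ => hη i
    have hSi := integrable_abs_sum_rpow hs hη hi (n + 1)
    have hcr := integrable_abs_rpow_mul_mul hs hS (hη (n + 1)) hSi (hi (n + 1))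
    have hz := setIntegral_cross_eq_zero (s := s) hη hind h0 n A hA
    have hI := setIntegral_mono (s := A) (hSi.add (hcr.const_mul s)).integrableOn
      (integrable_abs_sum_rpow hs hη hi (n + 2)).integrableOn (fun ω => by
        have := abs_rpow_tangent_le hs (∑ i ∈ Finset.range (n + 1), η i ω) (η (n + 1) ω)
        rw [← Finset.sum_range_succ] at this
        simp only [Pi.add_apply]
        linarith)
    refine le_trans (le_of_eq ?_) hI
    simp only [Pi.add_apply]
    rw [integral_add hSi.integrableOn (hcr.const_mul s).integrableOn, integral_const_mul, hz]
    ring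

/-- Doob's maximal inequality for the partial sums. -/
theorem measure_exists_le_abs_sum_le [IsFiniteMeasure P] (hs : 2 ≤ s)
    (hη : ∀ i, Measurable (η i)) (hind : iIndepFun η P)
    (h0 : ∀ i, ∫ ω, η i ω ∂P = 0) (hi : ∀ i, Integrable (fun ω => |η i ω| ^ s) P)
    {c : ℝ} (hc : 0 < c) (N : ℕ) :
    P {ω | ∃ k, 1 ≤ k ∧ k ≤ N ∧ c ≤ |∑ i ∈ Finset.range k, η i ω|} ≤
      ENNReal.ofReal ((∫ ω, |∑ i ∈ Finset.range N, η i ω| ^ s ∂P) / c ^ s) := by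
  rcases N with _ | N
  · have : {ω | ∃ k, 1 ≤ k ∧ k ≤ 0 ∧ c ≤ |∑ i ∈ Finset.range k, η i ω|} = ∅ := by
      ext ω
      simp only [Set.mem_ofPred_eq, Set.mem_empty_iff_false, iff_false]
      rintro ⟨k, h1, h2, -⟩
      omega
    rw [this]
    simp
  have hcs : 0 < c ^ s := Real.rpow_pos_of_pos hc s
  have hmax := maximal_ineq (submartingale_abs_sum_rpow hs hη hind h0 hi)
    (fun n ω => by positivity) (ε := (c ^ s).toNNReal) N
  rw [Real.coe_toNNReal _ hcs.le] at hmax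
  set E := {ω | c ^ s ≤ (Finset.range (N + 1)).sup' Finset.nonempty_range_add_one
    fun k => |∑ i ∈ Finset.range (k + 1), η i ω| ^ s} with hE
  have hsub : {ω | ∃ k, 1 ≤ k ∧ k ≤ N + 1 ∧ c ≤ |∑ i ∈ Finset.range k, η i ω|} ⊆ E := by
    rintro ω ⟨k, h1, h2, h3⟩
    obtain ⟨j, rfl⟩ : ∃ j, k = j + 1 := ⟨k - 1, by omega⟩
    exact (Real.rpow_le_rpow hc.le h3 (by linarith)).trans
      (Finset.le_sup' (fun k => |∑ i ∈ Finset.range (k + 1), η i ω| ^ s)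
        (Finset.mem_range.2 (by omega)))
  refine (measure_mono hsub).trans ?_
  rw [ENNReal.ofReal_div_of_pos hcs,
    ENNReal.le_div_iff_mul_le (Or.inl (by simpa using hcs)) (Or.inl ENNReal.ofReal_ne_top),
    mul_comm]
  refine hmax.trans (ENNReal.ofReal_le_ofReal ?_)
  exact setIntegral_le_integral (integrable_abs_sum_rpow hs hη hi (N + 1))
    (Filter.Eventually.of_forall fun ω => by positivity)

/-- A quantitative strong law: the averages stay small from time `n` on. -/
theorem exists_measure_tail_average_le {s : ℝ} (hs : 2 ≤ s) :
    ∃ B : ℝ, 0 < B ∧ ∀ {Ω : Type*} [MeasurableSpace Ω] {P : Measure Ω} [IsFiniteMeasure P]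
      {η : ℕ → Ω → ℝ} {L : ℝ},
      (∀ i, Measurable (η i)) → iIndepFun η P → (∀ i, ∫ ω, η i ω ∂P = 0) →
      (∀ i, Integrable (fun ω => |η i ω| ^ s) P) → (∀ i, ∫ ω, |η i ω| ^ s ∂P ≤ L) →
      ∀ {ε : ℝ}, 0 < ε → ∀ n : ℕ, 1 ≤ n →
        P.real {ω | ∃ k, n ≤ k ∧ ε * k ≤ |∑ i ∈ Finset.range k, η i ω|} ≤
          B * L * ε ^ (-s) * (n : ℝ) ^ (-s / 2) := by
  obtain ⟨K, hK0, hK⟩ := exists_integral_abs_sum_rpow_le hs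
  -- `2 ^ (s / 2)` comes from running each block to twice its left end, and the leading 2 is the
  -- geometric sum over blocks.
  refine ⟨2 * (K * 2 ^ (s / 2)), by positivity, ?_⟩
  intro Ω _ P _ η L hη hind h0 hi hL ε hε n hn
  have hL0 : 0 ≤ L := (integral_nonneg fun ω => by positivity).trans (hL 0)
  have hn0 : (0 : ℝ) < n := by exact_mod_cast hn
  set D : ℝ := K * 2 ^ (s / 2) * L * ε ^ (-s) * (n : ℝ) ^ (-s / 2) with hD
  have hD0 : 0 ≤ D := by positivity
  -- Dyadic blocks `2^j n ≤ k < 2^(j+1) n`, with `j = log₂ ⌊k / n⌋`; on each one the threshold `ε k`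
  -- is lowered to its value at the left end.
  have hsub : {ω | ∃ k, n ≤ k ∧ ε * k ≤ |∑ i ∈ Finset.range k, η i ω|} ⊆
      ⋃ j : ℕ, {ω | ∃ k, 1 ≤ k ∧ k ≤ 2 ^ (j + 1) * n ∧
        ε * (2 ^ j * n) ≤ |∑ i ∈ Finset.range k, η i ω|} := by
    rintro ω ⟨k, hnk, hk⟩
    rw [Set.mem_iUnion]
    have hd : k / n ≠ 0 := (Nat.div_pos hnk hn).ne'
    refine ⟨Nat.log 2 (k / n), k, hn.trans hnk, ?_, le_trans ?_ hk⟩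
    · exact ((Nat.div_lt_iff_lt_mul hn).1 (Nat.lt_pow_succ_log_self one_lt_two _)).le
    · refine mul_le_mul_of_nonneg_left ?_ hε.le
      exact_mod_cast (Nat.le_div_iff_mul_le hn).1 (Nat.pow_log_le_self 2 hd)
  have hblock : ∀ j : ℕ, P {ω | ∃ k, 1 ≤ k ∧ k ≤ 2 ^ (j + 1) * n ∧
        ε * (2 ^ j * n) ≤ |∑ i ∈ Finset.range k, η i ω|} ≤ ENNReal.ofReal (D * (1 / 2) ^ j) := by
    intro j
    refine (measure_exists_le_abs_sum_le hs hη hind h0 hi (by positivity) _).trans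
      (ENNReal.ofReal_le_ofReal ?_)
    have hm := hK hη hind h0 hi hL (2 ^ (j + 1) * n)
    push_cast at hm
    set N : ℝ := 2 ^ j * n with hN
    have hN0 : 0 < N := by positivity
    rw [show (2 : ℝ) ^ (j + 1) * n = 2 * N by rw [hN]; ring,
      Real.mul_rpow (by norm_num) hN0.le] at hm
    have e1 : N ^ (s / 2) / N ^ s = N ^ (-s / 2) := by
      rw [← Real.rpow_sub hN0]; congr 1; ring
    -- Here `s ≥ 2` makes the block bounds decay at least like `2^(-j)`.
    have e2 : N ^ (-s / 2) ≤ (1 / 2) ^ j * (n : ℝ) ^ (-s / 2) := by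
      rw [hN, Real.mul_rpow (by positivity) (by positivity)]
      refine mul_le_mul_of_nonneg_right ?_ (by positivity)
      calc ((2 : ℝ) ^ j) ^ (-s / 2) ≤ ((2 : ℝ) ^ j) ^ (-1 : ℝ) :=
            Real.rpow_le_rpow_of_exponent_le (one_le_pow₀ one_le_two) (by linarith)
        _ = (1 / 2) ^ j := by rw [Real.rpow_neg_one, one_div, inv_pow]
    calc _ ≤ K * (2 ^ (s / 2) * N ^ (s / 2)) * L / (ε * N) ^ s := by gcongr
      _ = K * 2 ^ (s / 2) * L * ε ^ (-s) * (N ^ (s / 2) / N ^ s) := by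
          rw [Real.mul_rpow hε.le hN0.le, Real.rpow_neg hε.le]
          field_simp
      _ ≤ K * 2 ^ (s / 2) * L * ε ^ (-s) * ((1 / 2) ^ j * (n : ℝ) ^ (-s / 2)) := by
          rw [e1]; gcongr
      _ = D * (1 / 2) ^ j := by rw [hD]; ring
  have htot : P {ω | ∃ k, n ≤ k ∧ ε * k ≤ |∑ i ∈ Finset.range k, η i ω|} ≤
      ENNReal.ofReal (D * 2) := by
    refine (measure_mono hsub).trans ((measure_iUnion_le _).trans
      ((ENNReal.tsum_le_tsum hblock).trans ?_))
    rw [← ENNReal.ofReal_tsum_of_nonneg (fun j => by positivity)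
      (summable_geometric_two.mul_left D), tsum_mul_left, tsum_geometric_two]
  refine (ENNReal.toReal_le_of_le_ofReal (by positivity) htot).trans_eq ?_
  rw [hD]
  ring

end PartialSums

/-! ### Convexity of the criterion functions and signs of their slopes -/

section Criterion

variable {S : Type*} {h : S → ℝ → ℝ} {t₀ : ℝ}

theorem ConvexOn.tendsto_slope_rightD {f : ℝ → ℝ} (hf : ConvexOn ℝ Set.univ f) (t : ℝ) :
    Filter.Tendsto (slope f t) (nhdsWithin t (Set.Ioi t)) (nhds (rightD f t)) := by
  have := hf.hasDerivWithinAt_rightDeriv_of_mem_interior (x := t) (by simp)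
  rwa [hasDerivWithinAt_iff_tendsto_slope' (by simp)] at this

theorem empCriterion_subgradient_le {Ω : Type*} (hc : ∀ x, ConvexOn ℝ Set.univ (h x))
    (X : ℕ → Ω → S) {k : ℕ} (hk : 1 ≤ k) (ω : Ω) (y u : ℝ) :
    (∑ i ∈ Finset.range k, rightD (h (X i ω)) y) * (u - y) ≤
      k * (empCriterion h t₀ X k ω u - empCriterion h t₀ X k ω y) := by
  have hk0 : (0 : ℝ) < k := by exact_mod_cast hk
  unfold empCriterion
  rw [← mul_sub, ← Finset.sum_sub_distrib, ← mul_assoc, mul_one_div_cancel hk0.ne', one_mul,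
    Finset.sum_mul]
  refine Finset.sum_le_sum fun i _ => ?_
  have := ConvexOn.subgradient_le (hc (X i ω)) y u
  linarith

/-- A point left of the smallest minimizer is not a minimizer, so the criterion strictly drops from
`y` to `mHat`, which forces a negative subgradient at `y`. -/
theorem sum_rightD_neg_of_lt_mHat {Ω : Type*} (hc : ∀ x, ConvexOn ℝ Set.univ (h x))
    {X : ℕ → Ω → S} {k : ℕ} (hk : 1 ≤ k) {ω : Ω}
    (hex : ∃ t, IsLeast (argminSet (empCriterion h t₀ X k ω)) t) {y : ℝ}
    (hy : y < mHat h t₀ X k ω) : ∑ i ∈ Finset.range k, rightD (h (X i ω)) y < 0 := by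
  have hl := mHat_isLeast hex
  have hlt : empCriterion h t₀ X k ω (mHat h t₀ X k ω) < empCriterion h t₀ X k ω y := by
    by_contra hle
    have : y ∈ argminSet (empCriterion h t₀ X k ω) := fun v => (not_lt.1 hle).trans (hl.1 v)
    exact absurd (hl.2 this) (not_le.2 hy)
  have hs := empCriterion_subgradient_le (t₀ := t₀) hc X hk ω y (mHat h t₀ X k ω)
  have hk0 : (0 : ℝ) < k := by exact_mod_cast hk
  have := mul_neg_of_pos_of_neg hk0 (sub_neg.2 hlt)
  by_contra hge
  have := mul_nonneg (not_lt.1 hge) (sub_pos.2 hy).le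
  linarith

theorem sum_rightD_nonneg_of_mHat_lt {Ω : Type*} (hc : ∀ x, ConvexOn ℝ Set.univ (h x))
    {X : ℕ → Ω → S} {k : ℕ} (hk : 1 ≤ k) {ω : Ω}
    (hex : ∃ t, IsLeast (argminSet (empCriterion h t₀ X k ω)) t) {y : ℝ}
    (hy : mHat h t₀ X k ω < y) : 0 ≤ ∑ i ∈ Finset.range k, rightD (h (X i ω)) y := by
  have hle := (mHat_isLeast hex).1 y
  have hs := empCriterion_subgradient_le (t₀ := t₀) hc X hk ω y (mHat h t₀ X k ω)
  have := mul_nonneg (Nat.cast_nonneg (α := ℝ) k) (sub_nonneg.2 hle)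
  by_contra hlt
  have := mul_pos_of_neg_of_neg (not_le.1 hlt) (sub_neg.2 hy)
  linarith

variable [MeasurableSpace S] {Q : Measure S}

theorem measurable_rightD (hm : ∀ t, Measurable fun x => h x t)
    (hc : ∀ x, ConvexOn ℝ Set.univ (h x)) (t : ℝ) : Measurable fun x => rightD (h x) t := by
  have hu : Filter.Tendsto (fun n : ℕ => t + 1 / ((n : ℝ) + 1)) Filter.atTop
      (nhdsWithin t (Set.Ioi t)) := by
    refine tendsto_nhdsWithin_iff.2 ⟨?_, Filter.Eventually.of_forall fun n => ?_⟩
    · simpa using (tendsto_one_div_add_atTop_nhds_zero_nat (𝕜 := ℝ)).const_add t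
    · have : (0 : ℝ) < 1 / ((n : ℝ) + 1) := by positivity
      simpa using this
  refine measurable_of_tendsto_metrizable (f := fun (n : ℕ) x =>
    slope (h x) t (t + 1 / ((n : ℝ) + 1))) (fun n => ?_) ?_
  · simp only [slope_def_field]
    exact ((hm _).sub (hm _)).div_const _
  · exact tendsto_pi_nhds.2 fun x => (ConvexOn.tendsto_slope_rightD (hc x) t).comp hu

/-- The subgradient inequalities at `t` and at `u` enclose the difference between two integrable
functions. -/
theorem integrable_sub (hm : ∀ t, Measurable fun x => h x t)
    (hc : ∀ x, ConvexOn ℝ Set.univ (h x)) (hi : ∀ t, Integrable (fun x => rightD (h x) t) Q)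
    (t u : ℝ) : Integrable (fun x => h x t - h x u) Q := by
  refine (((hi t).abs.add (hi u).abs).mul_const |t - u|).mono'
    ((hm t).sub (hm u)).aestronglyMeasurable (Filter.Eventually.of_forall fun x => ?_)
  have h1 := ConvexOn.subgradient_le (hc x) t u
  have h2 := ConvexOn.subgradient_le (hc x) u t
  have a1 : rightD (h x) t * (t - u) ≤ |rightD (h x) t| * |t - u| := by
    rw [← abs_mul]; exact le_abs_self _
  have a2 : -(|rightD (h x) u| * |t - u|) ≤ rightD (h x) u * (t - u) := by
    rw [← abs_mul]; exact neg_abs_le _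
  have p1 : 0 ≤ |rightD (h x) t| * |t - u| := by positivity
  have p2 : 0 ≤ |rightD (h x) u| * |t - u| := by positivity
  simp only [Pi.add_apply, Real.norm_eq_abs]
  rw [abs_le]
  constructor <;> linarith

theorem criterion_sub (hm : ∀ t, Measurable fun x => h x t)
    (hc : ∀ x, ConvexOn ℝ Set.univ (h x)) (hi : ∀ t, Integrable (fun x => rightD (h x) t) Q)
    (t u : ℝ) : criterion Q h t₀ u - criterion Q h t₀ t = ∫ x, (h x u - h x t) ∂Q := by
  unfold criterion
  rw [← integral_sub (integrable_sub hm hc hi _ _) (integrable_sub hm hc hi _ _)]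
  congr 1
  ext x
  ring

/-- Differentiation under the integral sign from the right. -/
theorem rightD_criterion (hm : ∀ t, Measurable fun x => h x t)
    (hc : ∀ x, ConvexOn ℝ Set.univ (h x)) (hi : ∀ t, Integrable (fun x => rightD (h x) t) Q)
    (t : ℝ) : rightD (criterion Q h t₀) t = ∫ x, rightD (h x) t ∂Q := by
  refine HasDerivWithinAt.derivWithin ?_ (uniqueDiffWithinAt_Ioi t)
  rw [hasDerivWithinAt_iff_tendsto_slope' (by simp)]
  have hsl : slope (criterion Q h t₀) t = fun u => ∫ x, slope (h x) t u ∂Q := by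
    ext u
    simp only [slope_def_field]
    rw [criterion_sub hm hc hi, integral_div]
  rw [hsl]
  -- For `t < u < t + 1` the slope from `t` to `u` lies between the right derivatives at `t` and `t
  -- + 1`.
  refine tendsto_integral_filter_of_dominated_convergence
    (fun x => |rightD (h x) t| + |rightD (h x) (t + 1)|) ?_ ?_ ((hi t).abs.add (hi (t + 1)).abs)
    (Filter.Eventually.of_forall fun x => ConvexOn.tendsto_slope_rightD (hc x) t)
  · refine Filter.Eventually.of_forall fun u => ?_
    simp only [slope_def_field]
    exact (((hm _).sub (hm _)).div_const _).aestronglyMeasurable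
  · filter_upwards [Ioo_mem_nhdsGT (show t < t + 1 by linarith)] with u hu
    refine Filter.Eventually.of_forall fun x => ?_
    have hpos : 0 < u - t := by linarith [hu.1]
    have h1 := ConvexOn.subgradient_le (hc x) t u
    have h2 := ConvexOn.subgradient_le (hc x) u t
    have hmono : rightD (h x) u ≤ rightD (h x) (t + 1) :=
      (hc x).monotoneOn_rightDeriv (by simp) (by simp) hu.2.le
    have l1 : rightD (h x) t ≤ slope (h x) t u := by
      rw [slope_def_field, le_div_iff₀ hpos]; linarith
    have l2 : slope (h x) t u ≤ rightD (h x) (t + 1) := by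
      refine le_trans ?_ hmono
      rw [slope_def_field, div_le_iff₀ hpos]; linarith
    have := neg_abs_le (rightD (h x) t)
    have := le_abs_self (rightD (h x) (t + 1))
    have := abs_nonneg (rightD (h x) t)
    have := abs_nonneg (rightD (h x) (t + 1))
    rw [Real.norm_eq_abs, abs_le]
    constructor <;> linarith

theorem criterion_subgradient_le [IsProbabilityMeasure Q] (hm : ∀ t, Measurable fun x => h x t)
    (hc : ∀ x, ConvexOn ℝ Set.univ (h x)) (hi : ∀ t, Integrable (fun x => rightD (h x) t) Q)
    (t u : ℝ) :
    rightD (criterion Q h t₀) t * (u - t) ≤ criterion Q h t₀ u - criterion Q h t₀ t := by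
  rw [rightD_criterion hm hc hi, criterion_sub hm hc hi, ← integral_mul_const]
  refine integral_mono ((hi t).mul_const _) (integrable_sub hm hc hi _ _) fun x => ?_
  have := ConvexOn.subgradient_le (hc x) t u
  linarith

theorem criterion_lt_of_argminSet_eq {M : ℝ → ℝ} {m u : ℝ} (hM : argminSet M = {m})
    (hu : u ≠ m) : M m < M u := by
  have hm : m ∈ argminSet M := by rw [hM]; rfl
  by_contra hle
  have : u ∈ argminSet M := fun v => (not_lt.1 hle).trans (hm v)
  rw [hM] at this
  exact hu this

/-- A nonpositive subgradient at `m + x` would give `M(m) ≥ M(m + x)`, against uniqueness of the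
minimizer. -/
theorem rightD_criterion_pos [IsProbabilityMeasure Q] (hm : ∀ t, Measurable fun x => h x t)
    (hc : ∀ x, ConvexOn ℝ Set.univ (h x)) (hi : ∀ t, Integrable (fun x => rightD (h x) t) Q)
    {m x : ℝ} (hM : argminSet (criterion Q h t₀) = {m}) (hx : 0 < x) :
    0 < rightD (criterion Q h t₀) (m + x) := by
  have h1 := criterion_subgradient_le (t₀ := t₀) hm hc hi (m + x) m
  have h2 := criterion_lt_of_argminSet_eq hM (show m + x ≠ m by linarith)
  by_contra hle
  have := mul_nonneg_of_nonpos_of_nonpos (not_lt.1 hle) (by linarith : m - (m + x) ≤ 0)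
  linarith

theorem rightD_criterion_neg [IsProbabilityMeasure Q] (hm : ∀ t, Measurable fun x => h x t)
    (hc : ∀ x, ConvexOn ℝ Set.univ (h x)) (hi : ∀ t, Integrable (fun x => rightD (h x) t) Q)
    {m x : ℝ} (hM : argminSet (criterion Q h t₀) = {m}) (hx : 0 < x) :
    0 < -rightD (criterion Q h t₀) (m - x) := by
  have h1 := criterion_subgradient_le (t₀ := t₀) hm hc hi (m - x) m
  have h2 := criterion_lt_of_argminSet_eq hM (show m - x ≠ m by linarith)
  by_contra hle
  have := mul_nonneg (by linarith : 0 ≤ rightD (criterion Q h t₀) (m - x))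
    (by linarith : 0 ≤ m - (m - x))
  linarith

end Criterion

/-! ### Centring, and the tail bound for right derivatives -/

/-- Centring costs at most a factor `2^s` in the absolute moment of order `s`. -/
theorem integral_abs_sub_integral_rpow_le {Ω : Type*} [MeasurableSpace Ω] {P : Measure Ω}
    [IsProbabilityMeasure P] {s : ℝ} (hs : 2 ≤ s) {ξ : Ω → ℝ} (hξ : Measurable ξ)
    (hξ1 : Integrable ξ P) (hi : Integrable (fun ω => |ξ ω| ^ s) P) :
    Integrable (fun ω => |ξ ω - ∫ ω', ξ ω' ∂P| ^ s) P ∧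
      ∫ ω, |ξ ω - ∫ ω', ξ ω' ∂P| ^ s ∂P ≤ 2 ^ s * ∫ ω, |ξ ω| ^ s ∂P := by
  set a := ∫ ω', ξ ω' ∂P with ha
  have hint : Integrable (fun ω => |ξ ω - a| ^ s) P :=
    integrable_abs_rpow_of_memLp hs
      ((memLp_of_integrable_abs_rpow hs hξ hi).sub (memLp_const a))
  refine ⟨hint, ?_⟩
  -- Jensen's inequality, by integrating the tangent line at the mean `a`.
  have hj : |a| ^ s ≤ ∫ ω, |ξ ω| ^ s ∂P := by
    have hpt : ∀ ω, |a| ^ s + s * (|a| ^ (s - 2) * a) * (ξ ω - a) ≤ |ξ ω| ^ s := fun ω => by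
      have := abs_rpow_tangent_le hs a (ξ ω - a)
      rwa [add_sub_cancel] at this
    have hl : Integrable (fun ω => s * (|a| ^ (s - 2) * a) * (ξ ω - a)) P :=
      (hξ1.sub (integrable_const a)).const_mul _
    have := integral_mono ((integrable_const (|a| ^ s)).add hl) hi hpt
    refine le_trans (le_of_eq ?_) this
    simp only [Pi.add_apply]
    rw [integral_add (integrable_const _) hl, integral_const_mul,
      integral_sub hξ1 (integrable_const a)]
    simp [ha]
  have hpt : ∀ ω, |ξ ω - a| ^ s ≤ 2 ^ (s - 1) * (|ξ ω| ^ s + |a| ^ s) := fun ω => by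
    have hadd : (|ξ ω| + |a|) ^ s ≤ 2 ^ (s - 1) * (|ξ ω| ^ s + |a| ^ s) := by
      simpa using NNReal.coe_le_coe.2 (NNReal.rpow_add_le_mul_rpow_add_rpow
        (Real.nnabs (ξ ω)) (Real.nnabs a) (by linarith : 1 ≤ s))
    refine le_trans ?_ hadd
    exact Real.rpow_le_rpow (abs_nonneg _) (abs_sub _ _) (by linarith)
  refine (integral_mono hint ((hi.add (integrable_const (|a| ^ s))).const_mul _) hpt).trans ?_
  rw [integral_const_mul]
  simp only [Pi.add_apply]
  rw [integral_add hi (integrable_const _)]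
  simp only [integral_const, probReal_univ, smul_eq_mul, one_mul]
  calc (2 : ℝ) ^ (s - 1) * (∫ ω, |ξ ω| ^ s ∂P + |a| ^ s)
      ≤ 2 ^ (s - 1) * (∫ ω, |ξ ω| ^ s ∂P + ∫ ω, |ξ ω| ^ s ∂P) := by gcongr
    _ = 2 ^ s * ∫ ω, |ξ ω| ^ s ∂P := by
        rw [Real.rpow_sub_one (by norm_num)]; ring

/-- Large deviations of the averaged right derivatives from their mean, from time `n` on. -/
theorem exists_measure_tail_rightD_le {s : ℝ} (hs : 2 ≤ s) :
    ∃ B : ℝ, 0 < B ∧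
      ∀ {S : Type*} [MeasurableSpace S] {Q : Measure S} {Ω : Type*} [MeasurableSpace Ω]
        {P : Measure Ω} [IsProbabilityMeasure P] {h : S → ℝ → ℝ} {X : ℕ → Ω → S} {m x : ℝ},
        (∀ t, Measurable fun x => h x t) → (∀ x, ConvexOn ℝ Set.univ (h x)) →
        (∀ t, Integrable (fun x => rightD (h x) t) Q) → (∀ i, Measurable (X i)) →
        iIndepFun X P → (∀ i, P.map (X i) = Q) → absMoment P h (X 0) m s x < ∞ →
        ∀ {ε : ℝ}, 0 < ε → ∀ n : ℕ, 1 ≤ n →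
          P.real {ω | ∃ k, n ≤ k ∧ ε * k ≤ |∑ i ∈ Finset.range k,
              (rightD (h (X i ω)) (m + x) - ∫ y, rightD (h y) (m + x) ∂Q)|} ≤
            2 ^ s * B * (absMoment P h (X 0) m s x).toReal * ε ^ (-s) * (n : ℝ) ^ (-s / 2) := by
  obtain ⟨B, hB0, hB⟩ := exists_measure_tail_average_le hs
  refine ⟨B, hB0, ?_⟩
  intro S _ Q Ω _ P _ h X m x hm hc hi hX hind hQ hmom ε hε n hn
  set g : S → ℝ := fun y => rightD (h y) (m + x) with hg
  have hgm : Measurable g := measurable_rightD hm hc _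
  have hgs : Measurable fun y => |g y| ^ s := by fun_prop
  have hcomp : ∀ i, ∫ ω, g (X i ω) ∂P = ∫ y, g y ∂Q := fun i => by
    rw [← hQ i, integral_map (hX i).aemeasurable hgm.aestronglyMeasurable]
  have hint1 : ∀ i, Integrable (fun ω => g (X i ω)) P := fun i => by
    have := hi (m + x)
    rw [← hQ i] at this
    exact this.comp_measurable (hX i)
  have hint0 : Integrable (fun ω => |g (X 0 ω)| ^ s) P := by
    refine ⟨(hgs.comp (hX 0)).aestronglyMeasurable, ?_⟩
    rw [hasFiniteIntegral_iff_ofReal (Filter.Eventually.of_forall fun ω => by positivity)]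
    exact hmom
  have hintQ : Integrable (fun y => |g y| ^ s) Q := by
    rw [← hQ 0, integrable_map_measure hgs.aestronglyMeasurable (hX 0).aemeasurable]
    exact hint0
  have hints : ∀ i, Integrable (fun ω => |g (X i ω)| ^ s) P := fun i => by
    have := hintQ
    rw [← hQ i] at this
    exact this.comp_measurable (hX i)
  have hL : ∀ i, ∫ ω, |g (X i ω)| ^ s ∂P = (absMoment P h (X 0) m s x).toReal := fun i => by
    have e0 : (absMoment P h (X 0) m s x).toReal = ∫ ω, |g (X 0 ω)| ^ s ∂P := by
      rw [integral_eq_lintegral_of_nonneg_ae (Filter.Eventually.of_forall fun ω => by positivity)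
        hint0.aestronglyMeasurable]
      rfl
    have e : ∀ j, ∫ ω, |g (X j ω)| ^ s ∂P = ∫ y, |g y| ^ s ∂Q := fun j => by
      rw [← hQ j, integral_map (hX j).aemeasurable hgs.aestronglyMeasurable]
    rw [e0, e, e]
  have hcen := fun i => integral_abs_sub_integral_rpow_le hs (hgm.comp (hX i)) (hint1 i) (hints i)
  simp only [Function.comp_apply, hcomp, hL] at hcen
  have := hB (P := P) (η := fun i ω => g (X i ω) - ∫ y, g y ∂Q)
    (fun i => (hgm.comp (hX i)).sub_const _)
    (hind.comp (fun _ y => g y - ∫ y, g y ∂Q) fun _ => hgm.sub_const _)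
    (fun i => by
      rw [integral_sub (hint1 i) (integrable_const _), hcomp]
      simp)
    (fun i => (hcen i).1) (fun i => (hcen i).2) hε n hn
  refine this.trans_eq ?_
  ring

end ConvexMEst

/-! ### The theorem -/

theorem mainTheorem2 (s : ℝ) (hs : 2 ≤ s) :
    ∃ B : ℝ, 0 < B ∧
      ∀ (S : Type*) [MeasurableSpace S] (Q : Measure S) [IsProbabilityMeasure Q]
        (Ω : Type*) [MeasurableSpace Ω] (P : Measure Ω) [IsProbabilityMeasure P]
        (h : S → ℝ → ℝ) (t₀ : ℝ) (X : ℕ → Ω → S) (m x₀ : ℝ),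
        (∀ t, Measurable fun x => h x t) →
        (∀ x, ConvexOn ℝ Set.univ (h x)) →
        (∀ t, Integrable (fun x => ConvexMEst.rightD (h x) t) Q) →
        (∀ t, Integrable (fun x => ConvexMEst.leftD (h x) t) Q) →
        (∀ i, Measurable (X i)) →
        iIndepFun X P →
        (∀ i, P.map (X i) = Q) →
        -- the smallest minimizing points of the empirical criterion functions exist
        (∀ k : ℕ, 1 ≤ k → ∀ᵐ ω ∂P,
          ∃ t, IsLeast (ConvexMEst.argminSet (ConvexMEst.empCriterion h t₀ X k ω)) t) →
        -- `m` is the unique minimizing point of `M`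
        ConvexMEst.argminSet (ConvexMEst.criterion Q h t₀) = {m} →
        0 < x₀ →
        (∀ x ∈ Set.Icc (-x₀) x₀, ConvexMEst.absMoment P h (X 0) m s x < ∞) →
        ∀ x ∈ Set.Ioc 0 x₀,
          0 < ConvexMEst.slopeGap (ConvexMEst.criterion Q h t₀) m x ∧
          ConvexMEst.maxMoment P h (X 0) m s x < ∞ ∧
          ∀ n : ℕ, 1 ≤ n →
            P.real {ω | (x : EReal) <
                ⨆ k ≥ n, ((ConvexMEst.mHat h t₀ X k ω - m : ℝ) : EReal)} ≤
              2 ^ s * B * (ConvexMEst.absMoment P h (X 0) m s x).toReal *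
                ConvexMEst.rightD (ConvexMEst.criterion Q h t₀) (m + x) ^ (-s) *
                (n : ℝ) ^ (-s / 2) ∧
            P.real {ω | (⨅ k ≥ n, ((ConvexMEst.mHat h t₀ X k ω - m : ℝ) : EReal)) <
                ((-x : ℝ) : EReal)} ≤
              2 ^ s * B * (ConvexMEst.absMoment P h (X 0) m s (-x)).toReal *
                (-ConvexMEst.rightD (ConvexMEst.criterion Q h t₀) (m - x)) ^ (-s) *
                (n : ℝ) ^ (-s / 2) ∧
            P.real {ω | (x : EReal) <
                ⨆ k ≥ n, ((|ConvexMEst.mHat h t₀ X k ω - m| : ℝ) : EReal)} ≤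
              2 ^ (s + 1) * B * (ConvexMEst.maxMoment P h (X 0) m s x).toReal *
                ConvexMEst.slopeGap (ConvexMEst.criterion Q h t₀) m x ^ (-s) *
                (n : ℝ) ^ (-s / 2) := by
  obtain ⟨B, hB0, hB⟩ := ConvexMEst.exists_measure_tail_rightD_le hs
  refine ⟨B, hB0, ?_⟩
  intro S _ Q _ Ω _ P _ h t₀ X m x₀ hm hc hi _ hX hind hQ hex hM hx₀ hmom x hx
  have hpos := ConvexMEst.rightD_criterion_pos hm hc hi hM hx.1
  have hneg := ConvexMEst.rightD_criterion_neg hm hc hi hM hx.1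
  have hR₁ := hmom x ⟨by linarith [hx.1], hx.2⟩
  have hR₂ := hmom (-x) ⟨by linarith [hx.2], by linarith [hx.1]⟩
  have hd : 0 < ConvexMEst.slopeGap (ConvexMEst.criterion Q h t₀) m x := lt_min hpos hneg
  have hmax : ConvexMEst.maxMoment P h (X 0) m s x < ∞ := max_lt hR₁ hR₂
  refine ⟨hd, hmax, fun n hn => ?_⟩
  -- Countably many null sets are merged, so that one almost sure event serves all `k`.
  have hall : ∀ᵐ ω ∂P, ∀ k : ℕ, 1 ≤ k →
      ∃ t, IsLeast (ConvexMEst.argminSet (ConvexMEst.empCriterion h t₀ X k ω)) t := by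
    rw [ae_all_iff]
    intro k
    by_cases hk : 1 ≤ k
    · filter_upwards [hex k hk] with ω hω _ using hω
    · exact Filter.Eventually.of_forall fun ω hk' => absurd hk' hk
  have upper : P.real {ω | (x : EReal) <
      ⨆ k ≥ n, ((ConvexMEst.mHat h t₀ X k ω - m : ℝ) : EReal)} ≤
      2 ^ s * B * (ConvexMEst.absMoment P h (X 0) m s x).toReal *
        ConvexMEst.rightD (ConvexMEst.criterion Q h t₀) (m + x) ^ (-s) * (n : ℝ) ^ (-s / 2) := by
    refine le_trans (ENNReal.toReal_mono (measure_ne_top _ _) (measure_mono_ae ?_))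
      (hB hm hc hi hX hind hQ hR₁ hpos n hn)
    filter_upwards [hall] with ω hω hlt
    -- Strict excess of the supremum, even an infinite one, is witnessed by a single `k ≥ n`. There
    -- the sum is negative, so it lies at least `k * D⁺M(m + x)` below its mean.
    obtain ⟨k, hlt⟩ := lt_iSup_iff.1 hlt
    obtain ⟨hk, hlt⟩ := lt_iSup_iff.1 hlt
    have hlt' : x < ConvexMEst.mHat h t₀ X k ω - m := EReal.coe_lt_coe_iff.1 hlt
    have hsum := ConvexMEst.sum_rightD_neg_of_lt_mHat hc (hn.trans hk) (hω k (hn.trans hk))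
      (show m + x < ConvexMEst.mHat h t₀ X k ω by linarith)
    refine ⟨k, hk, le_trans ?_ (neg_le_abs _)⟩
    rw [Finset.sum_sub_distrib, Finset.sum_const, Finset.card_range, nsmul_eq_mul,
      ConvexMEst.rightD_criterion hm hc hi]
    linarith
  have lower : P.real {ω | (⨅ k ≥ n, ((ConvexMEst.mHat h t₀ X k ω - m : ℝ) : EReal)) <
      ((-x : ℝ) : EReal)} ≤
      2 ^ s * B * (ConvexMEst.absMoment P h (X 0) m s (-x)).toReal *
        (-ConvexMEst.rightD (ConvexMEst.criterion Q h t₀) (m - x)) ^ (-s) *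
        (n : ℝ) ^ (-s / 2) := by
    refine le_trans (ENNReal.toReal_mono (measure_ne_top _ _) (measure_mono_ae ?_))
      (hB hm hc hi hX hind hQ hR₂ hneg n hn)
    filter_upwards [hall] with ω hω hlt
    obtain ⟨k, hlt⟩ := iInf_lt_iff.1 hlt
    obtain ⟨hk, hlt⟩ := iInf_lt_iff.1 hlt
    have hlt' : ConvexMEst.mHat h t₀ X k ω - m < -x := EReal.coe_lt_coe_iff.1 hlt
    have hsum := ConvexMEst.sum_rightD_nonneg_of_mHat_lt hc (hn.trans hk) (hω k (hn.trans hk))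
      (show ConvexMEst.mHat h t₀ X k ω < m + -x by linarith)
    -- Now the sum is nonnegative and its mean negative, so the deviation is upward.
    refine ⟨k, hk, le_trans ?_ (le_abs_self _)⟩
    rw [Finset.sum_sub_distrib, Finset.sum_const, Finset.card_range, nsmul_eq_mul,
      ConvexMEst.rightD_criterion hm hc hi, sub_eq_add_neg m x]
    linarith
  refine ⟨upper, lower, ?_⟩
  have hsub : {ω | (x : EReal) < ⨆ k ≥ n, ((|ConvexMEst.mHat h t₀ X k ω - m| : ℝ) : EReal)} ⊆
      {ω | (x : EReal) < ⨆ k ≥ n, ((ConvexMEst.mHat h t₀ X k ω - m : ℝ) : EReal)} ∪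
      {ω | (⨅ k ≥ n, ((ConvexMEst.mHat h t₀ X k ω - m : ℝ) : EReal)) < ((-x : ℝ) : EReal)} := by
    intro ω (hω : (x : EReal) < ⨆ k ≥ n, ((|ConvexMEst.mHat h t₀ X k ω - m| : ℝ) : EReal))
    obtain ⟨k, hlt⟩ := lt_iSup_iff.1 hω
    obtain ⟨hk, hlt⟩ := lt_iSup_iff.1 hlt
    rcases lt_abs.1 (EReal.coe_lt_coe_iff.1 hlt) with hlt | hlt
    · refine Or.inl ?_
      rw [Set.mem_ofPred_eq, lt_iSup_iff]
      exact ⟨k, lt_iSup_iff.2 ⟨hk, EReal.coe_lt_coe_iff.2 hlt⟩⟩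
    · refine Or.inr ?_
      rw [Set.mem_ofPred_eq, iInf_lt_iff]
      exact ⟨k, iInf_lt_iff.2 ⟨hk, EReal.coe_lt_coe_iff.2 (by linarith)⟩⟩
  have hμ₁ : (ConvexMEst.absMoment P h (X 0) m s x).toReal ≤
      (ConvexMEst.maxMoment P h (X 0) m s x).toReal :=
    ENNReal.toReal_mono hmax.ne (le_max_left _ _)
  have hμ₂ : (ConvexMEst.absMoment P h (X 0) m s (-x)).toReal ≤
      (ConvexMEst.maxMoment P h (X 0) m s x).toReal :=
    ENNReal.toReal_mono hmax.ne (le_max_right _ _)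
  have hd₁ : ConvexMEst.rightD (ConvexMEst.criterion Q h t₀) (m + x) ^ (-s) ≤
      ConvexMEst.slopeGap (ConvexMEst.criterion Q h t₀) m x ^ (-s) :=
    Real.rpow_le_rpow_of_nonpos hd (min_le_left _ _) (by linarith)
  have hd₂ : (-ConvexMEst.rightD (ConvexMEst.criterion Q h t₀) (m - x)) ^ (-s) ≤
      ConvexMEst.slopeGap (ConvexMEst.criterion Q h t₀) m x ^ (-s) :=
    Real.rpow_le_rpow_of_nonpos hd (min_le_right _ _) (by linarith)
  have hp₁ : 0 ≤ ConvexMEst.rightD (ConvexMEst.criterion Q h t₀) (m + x) ^ (-s) :=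
    Real.rpow_nonneg hpos.le _
  have hp₂ : 0 ≤ (-ConvexMEst.rightD (ConvexMEst.criterion Q h t₀) (m - x)) ^ (-s) :=
    Real.rpow_nonneg hneg.le _
  have hmono : ∀ {R d : ℝ}, 0 ≤ d →
      R ≤ (ConvexMEst.maxMoment P h (X 0) m s x).toReal →
      d ≤ ConvexMEst.slopeGap (ConvexMEst.criterion Q h t₀) m x ^ (-s) →
      2 ^ s * B * R * d * (n : ℝ) ^ (-s / 2) ≤
        2 ^ s * B * (ConvexMEst.maxMoment P h (X 0) m s x).toReal *
          ConvexMEst.slopeGap (ConvexMEst.criterion Q h t₀) m x ^ (-s) * (n : ℝ) ^ (-s / 2) := by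
    intro R d hd0 hR hd
    gcongr
  calc _ ≤ _ := measureReal_mono hsub (measure_ne_top _ _)
    _ ≤ _ := measureReal_union_le _ _
    _ ≤ _ := add_le_add (upper.trans (hmono hp₁ hμ₁ hd₁)) (lower.trans (hmono hp₂ hμ₂ hd₂))
    _ = _ := by
      -- The two one-sided tails share a common bound; adding them turns `2 ^ s` into `2 ^ (s + 1)`.
      rw [Real.rpow_add_one two_ne_zero]
      ring
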